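/- Let $n\ge 2$ be an integer and let $M_n=\mathrm{SL}(n,\mathbb R)/\mathrm{SL}(n,\mathbb Z)$ be the space of left cosets $g\,\mathrm{SL}(n,\mathbb Z)$, on which $\mathrm{SL}(n,\mathbb R)$ acts by left translation. For $m_1,m_2\in M_n$ let $C_{m_1,m_2}$ be the set of parametrized curves $c(t)=\exp(tx)\cdot m$, $0\le t\le 1$, with $m\in M_n$ and $x$ a real $n\times n$ matrix of trace zero, such that $c(0)=m_1$ and $c(1)=m_2$. The pair $m_1,m_2$ is called midpoint blockable if the set $\{c(1/2): c\in C_{m_1,m_2}\}$ is finite. Then: 1. For every $n\ge 2$, the space $M_n$ contains pairs of distinct points $m_1\neq m_2$ that are not midpoint blockable. 2. For every $n\ge 2$ and every $m\in M_n$, the pair $m,m$ is not midpoint blockable (no point is midpoint blockable away from itself). 3. For $n=2$, no pair $m_1,m_2\in M_2$ (equal or not) is midpoint blockable. Moreover, for every $g\in \mathrm{SL}(2,\mathbb R)$ the $\mathbb Z$-submodule of $\mathbb R$ generated by all entries of all matrices $X\in\mathrm{SL}(2,\mathbb R)$ with $X^2\in g\,\mathrm{SL}(2,\mathbb Z)$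 has infinite rank. -/

import Mathlib

namespace MidpointBlocking

open scoped Matrix.Norms.Operator in
/-- The exponential of a real matrix of trace zero has determinant one. -/
theorem det_exp_of_trace_eq_zero {n : ℕ} (x : Matrix (Fin n) (Fin n) ℝ) (hx : x.trace = 0) :
    (NormedSpace.exp x).det = 1 := by
  have hdet : Differentiable ℝ (fun A : Matrix (Fin n) (Fin n) ℝ => A.det) := by
    have hentry : ∀ i j, Differentiable ℝ (fun A : Matrix (Fin n) (Fin n) ℝ => A i j) := by
      intro i j
      exact (LinearMap.toContinuousLinearMap (Matrix.entryLinearMap ℝ ℝ i j)).differentiable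
    simp only [Matrix.det_apply]
    fun_prop
  set D := fderiv ℝ (fun A : Matrix (Fin n) (Fin n) ℝ => A.det) 1 with hD
  have hD1 : HasFDerivAt (fun A : Matrix (Fin n) (Fin n) ℝ => A.det) D 1 :=
    (hdet 1).hasFDerivAt
  have h1 : HasDerivAt (fun t : ℝ => (1 + t • x).det) (D x) 0 := by
    have hc : HasDerivAt (fun t : ℝ => 1 + t • x) x 0 := by
      have h := ((hasDerivAt_id (0 : ℝ)).smul_const x).const_add (1 : Matrix (Fin n) (Fin n) ℝ)
      rw [one_smul] at h
      exact h
    refine HasFDerivAt.comp_hasDerivAt (l := fun A : Matrix (Fin n) (Fin n) ℝ => A.det)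
      (l' := D) (0 : ℝ) ?_ hc
    rw [zero_smul, add_zero]
    exact hD1
  have h2 : HasDerivAt (fun t : ℝ => (1 + t • x).det) 0 0 := by
    have e : (fun t : ℝ => (1 + t • x).det) = fun t =>
        (Matrix.det (1 + (Polynomial.X : Polynomial ℝ) • x.map Polynomial.C)).eval t := by
      funext t
      rw [← Polynomial.coe_evalRingHom, RingHom.map_det]
      congr 1
      ext i j
      by_cases h : i = j <;> simp [h] <;> ring
    rw [e]
    have := (Matrix.det (1 + (Polynomial.X : Polynomial ℝ) • x.map Polynomial.C)).hasDerivAt 0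
    rwa [Matrix.derivative_det_one_add_X_smul, hx] at this
  have hDx : D x = 0 := h1.unique h2
  have h3 : HasDerivAt (fun t : ℝ => (NormedSpace.exp (t • x)).det) 0 0 := by
    have hc := hasDerivAt_exp_smul_const (𝕂 := ℝ) x (0 : ℝ)
    have h := HasFDerivAt.comp_hasDerivAt (l := fun A : Matrix (Fin n) (Fin n) ℝ => A.det)
      (l' := D) (0 : ℝ) (by rw [zero_smul, NormedSpace.exp_zero]; exact hD1) hc
    rw [zero_smul, NormedSpace.exp_zero, one_mul] at h
    exact h.congr_deriv hDx
  have hadd : ∀ s t : ℝ, (NormedSpace.exp ((s + t) • x)).det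
      = (NormedSpace.exp (s • x)).det * (NormedSpace.exp (t • x)).det := by
    intro s t
    rw [add_smul, Matrix.exp_add_of_commute _ _
      (((Commute.refl x).smul_left s).smul_right t), Matrix.det_mul]
  have h4 : ∀ s : ℝ, HasDerivAt (fun t : ℝ => (NormedSpace.exp (t • x)).det) 0 s := by
    intro s
    have hs : HasDerivAt (fun t : ℝ => (NormedSpace.exp ((t - s) • x)).det) 0 s := by
      have := HasDerivAt.comp_sub_const s s (by simpa using h3)
      simpa using this
    have := hs.const_mul (NormedSpace.exp (s • x)).det
    rw [mul_zero] at this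
    refine this.congr_of_eventuallyEq (Filter.Eventually.of_forall fun t => ?_)
    simp only
    rw [← hadd]
    simp
  have h5 := is_const_of_deriv_eq_zero (fun s => (h4 s).differentiableAt)
    (fun s => (h4 s).deriv) 1 0
  simpa using h5

/-- The Lie group `SL(n, ℝ)`. -/
abbrev SLR (n : ℕ) : Type := Matrix.SpecialLinearGroup (Fin n) ℝ

/-- The subgroup `SL(n, ℤ)` of `SL(n, ℝ)`: the matrices with integer entries. -/
def SLZ (n : ℕ) : Subgroup (SLR n) :=
  (Matrix.SpecialLinearGroup.map (n := Fin n) (Int.castRingHom ℝ)).range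

/-- The homogeneous space `SL(n, ℝ) / SL(n, ℤ)` of left cosets `g SL(n, ℤ)`, on which `SL(n, ℝ)`
acts by left translations. -/
abbrev M (n : ℕ) : Type := SLR n ⧸ SLZ n

/-- The exponential map `𝔰𝔩(n, ℝ) → SL(n, ℝ)`, i.e. the matrix exponential. -/
noncomputable def slExp {n : ℕ} (x : LieAlgebra.SpecialLinear.sl (Fin n) ℝ) : SLR n :=
  ⟨NormedSpace.exp (x : Matrix (Fin n) (Fin n) ℝ),
    det_exp_of_trace_eq_zero _ (LinearMap.mem_ker.1 x.2)⟩

/-- The connecting curves of a pair `m₁, m₂`: the parametrized curves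
`c(t) = exp(t x) · m`, `0 ≤ t ≤ 1`, with `x ∈ 𝔰𝔩(n, ℝ)`, `c(0) = m₁` and `c(1) = m₂`. -/
def connectingCurves {n : ℕ} (m₁ m₂ : M n) : Set (unitInterval → M n) :=
  {c | (∃ (x : LieAlgebra.SpecialLinear.sl (Fin n) ℝ) (m : M n),
      ∀ t : unitInterval, c t = slExp ((t : ℝ) • x) • m) ∧ c 0 = m₁ ∧ c 1 = m₂}

/-- The midpoint `1/2` of `[0, 1]`. -/
noncomputable def half : unitInterval := ⟨1 / 2, by norm_num, by norm_num⟩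

/-- A pair `m₁, m₂` is midpoint blockable if the set of the midpoints `c(1/2)` of its connecting
curves `c` is finite. -/
def MidpointBlockable {n : ℕ} (m₁ m₂ : M n) : Prop :=
  {p : M n | ∃ c ∈ connectingCurves m₁ m₂, p = c half}.Finite

/-- The square root `{X : X² ∈ A}` of a subset `A` of a group. -/
def Sqrt {G : Type*} [Group G] (A : Set G) : Set G := {X | X ^ 2 ∈ A}

/-- The coset `g SL(n, ℤ)`, as a subset of `SL(n, ℝ)`. -/
def coset {n : ℕ} (g : SLR n) : Set (SLR n) := {h | ∃ γ ∈ SLZ n, h = g * γ}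

/-- The `ℤ`-submodule of `ℝ` generated by all entries of all matrices in a set `A`. -/
def entryModule {n : ℕ} (A : Set (SLR n)) : Submodule ℤ ℝ :=
  Submodule.span ℤ {r | ∃ X ∈ A, ∃ i j : Fin n, r = (X : Matrix (Fin n) (Fin n) ℝ) i j}

end MidpointBlocking

namespace MidpointBlocking

/-! Everything reduces to one arithmetic fact about `SL(2)`: the square roots `X` of elements of `g
SL(2, ℤ)`, even those of trace above 2, do not all have entries in one finite-dimensional rational
space `V` (`exists_entry_sqrt_coset_notMem`). The rank claim follows at once. For midpoints, such an
`X` is an exponential, and so is its block embedding in `SL(n)`; hence its coset is a midpoint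
between the base point and `g`. Finitely many midpoints would put the entries of all these `X` in
the rational span of finitely many numbers.

For the arithmetic fact, moving along the coset by unitriangular matrices produces roots with trace
`√q √(c + k)` and lower-left entry `± √q / √(c + k)`, for every natural `k`. After rescaling, `V`
contains all `√(c + k)` and their inverses. Products of the inverses put all `1 / (c + k)` in the
finite-dimensional space `V * V`, and a linear relation among them makes `c` algebraic. So all `√(c
+ k)` lie in one real number field. This is impossible: their `d`-th finite differences, `d` being
the degree, are nonzero and, up to a fixed denominator, integral, yet too small at the real place to
have norm at least 1 (`IntermediateField.exists_sqrt_add_natCast_notMem`). -/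

/-! ### Finite differences of the square root -/

/-- Iterated mean value theorem: differencing commutes with differentiation, so the induction runs
on the differenced family, and one further mean value step removes the last difference. -/
theorem exists_fwdDiff_iter_eq (r : ℕ) : ∀ F : ℕ → ℝ → ℝ,
    (∀ i x, 0 < x → HasDerivAt (F i) (F (i + 1) x) x) →
    ∀ x, 0 < x → ∃ ξ, x ≤ ξ ∧ (fwdDiff (1 : ℝ))^[r] (F 0) x = F r ξ := by
  induction r with
  | zero => exact fun F _ x _ => ⟨x, le_rfl, rfl⟩
  | succ r ih =>
    intro F hF x hx
    obtain ⟨ξ, hξ, h⟩ := ih (fun i => fwdDiff 1 (F i)) (fun i y hy => by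
      have h1 : HasDerivAt (fun z => F i (z + 1)) (F (i + 1) (y + 1)) y :=
        (hF i (y + 1) (by linarith)).comp_add_const y 1
      exact h1.sub (hF i y hy)) x hx
    obtain ⟨η, hη, h'⟩ := exists_hasDerivAt_eq_slope (F r) (F (r + 1)) (lt_add_one ξ)
      (fun y hy => (hF r y (by linarith [hy.1])).continuousAt.continuousWithinAt)
      (fun y hy => hF r y (by linarith [hy.1]))
    refine ⟨η, by linarith [hη.1], ?_⟩
    rw [Function.iterate_succ_apply, h, h']
    simp [fwdDiff]

/-- The finite differences of the square root do not vanish, and those of high order decay fast. -/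
theorem fwdDiff_iter_sqrt_bound (r : ℕ) (hr : 1 ≤ r) : ∃ C : ℝ, ∀ x : ℝ, 0 < x →
    (fwdDiff (1 : ℝ))^[r] Real.sqrt x ≠ 0 ∧
      |(fwdDiff (1 : ℝ))^[r] Real.sqrt x| * x ^ r ≤ C * √x := by
  -- The `i`-th derivative of `√y` is `a i * y ^ (1/2 - i)`; no factor vanishes because `1/2` is not
  -- a natural number.
  let a : ℕ → ℝ := fun i => ∏ j ∈ Finset.range i, (1 / 2 - (j : ℝ))
  have ha : ∀ i, a i ≠ 0 := fun i => Finset.prod_ne_zero_iff.2 fun j _ h => by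
    have h2 : (1 : ℝ) = ((2 * j : ℕ) : ℝ) := by push_cast; linarith
    have h3 : 1 = 2 * j := by exact_mod_cast h2
    omega
  refine ⟨|a r|, fun x hx => ?_⟩
  obtain ⟨ξ, hξ, h⟩ := exists_fwdDiff_iter_eq r (fun i y => a i * y ^ (1 / 2 - (i : ℝ)))
    (fun i y hy => by
      have h1 := (Real.hasDerivAt_rpow_const (p := 1 / 2 - (i : ℝ)) (Or.inl hy.ne')).const_mul (a i)
      refine h1.congr_deriv ?_
      have h2 : a (i + 1) = a i * (1 / 2 - (i : ℝ)) := Finset.prod_range_succ _ _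
      have h3 : (1 / 2 - ((i + 1 : ℕ) : ℝ)) = 1 / 2 - (i : ℝ) - 1 := by push_cast; ring
      simp only [h2, h3, mul_assoc]) x hx
  have h0 : (fun y : ℝ => a 0 * y ^ (1 / 2 - ((0 : ℕ) : ℝ))) = Real.sqrt := by
    funext y
    simp [a, Real.sqrt_eq_rpow]
  rw [h0] at h
  have hξ0 : 0 < ξ := hx.trans_le hξ
  rw [h]
  refine ⟨mul_ne_zero (ha r) (Real.rpow_pos_of_pos hξ0 _).ne', ?_⟩
  rw [abs_mul, abs_of_pos (Real.rpow_pos_of_pos hξ0 _), mul_assoc]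
  refine mul_le_mul_of_nonneg_left ?_ (abs_nonneg _)
  have hr' : (1 : ℝ) ≤ r := by exact_mod_cast hr
  calc ξ ^ (1 / 2 - (r : ℝ)) * x ^ r ≤ x ^ (1 / 2 - (r : ℝ)) * x ^ r :=
        mul_le_mul_of_nonneg_right
          (Real.rpow_le_rpow_of_nonpos hx hξ (by linarith)) (by positivity)
    _ = √x := by
        rw [← Real.rpow_natCast, ← Real.rpow_add hx, Real.sqrt_eq_rpow]
        congr 1
        ring

/-! ### Square roots of an arithmetic progression in a number field -/

theorem one_le_prod_norm_embeddings {L : Type*} [Field L] [Algebra ℚ L] [FiniteDimensional ℚ L]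
    {z : L} (hz : IsIntegral ℤ z) (hz0 : z ≠ 0) : 1 ≤ ∏ σ : L →ₐ[ℚ] ℂ, ‖σ z‖ := by
  have h := Algebra.norm_eq_prod_embeddings ℚ ℂ z
  rw [← norm_prod, ← h]
  obtain ⟨m, hm⟩ := IsIntegrallyClosed.isIntegral_iff.1 (Algebra.isIntegral_norm ℚ hz)
  have hm0 : m ≠ 0 := by
    rintro rfl
    exact Algebra.norm_ne_zero_iff.2 hz0 (hm.symm.trans (map_zero _))
  rw [← hm]
  simpa using (by exact_mod_cast Int.one_le_abs hm0 : (1 : ℝ) ≤ |(m : ℝ)|)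

/-- With `d = [L : ℚ]` and `x = c + k`, the `d`-th difference of the roots is `O(x ^ (1/2 - d))` at
the real place and `O(x ^ (1/2))` at the other `d - 1` embeddings, so its norm is `O(x ^ (-d/2))`. A
nonzero algebraic integer cannot have norm tending to 0. -/
theorem IntermediateField.exists_sqrt_add_natCast_notMem (L : IntermediateField ℚ ℝ)
    [FiniteDimensional ℚ L] {c : ℝ} (hc : 0 < c) : ∃ k : ℕ, √(c + k) ∉ L := by
  classical
  by_contra! hL
  have hcL : c ∈ L := by
    have := mul_mem (hL 0) (hL 0)
    rwa [Nat.cast_zero, add_zero, Real.mul_self_sqrt hc.le] at this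
  have halg : IsAlgebraic ℤ (⟨c, hcL⟩ : L) :=
    (IsFractionRing.isAlgebraic_iff ℤ ℚ L).2 (Algebra.IsAlgebraic.isAlgebraic _)
  -- One `D` clears denominators for all `k`, since `(D √(c + k))² = D (D c) + D² k`.
  obtain ⟨D, hD0, hD⟩ := halg.exists_integral_multiple
  let y : ℕ → L := fun k => D • ⟨√(c + k), hL k⟩
  have hy2 : ∀ k, y k ^ 2 = D • D • (⟨c, hcL⟩ : L) + ((D ^ 2 * k : ℤ) : L) := by
    intro k
    apply Subtype.ext
    have : √(c + k) ^ 2 = c + k := Real.sq_sqrt (by positivity)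
    simp [y, mul_pow, this]
    ring
  have hyint : ∀ k, IsIntegral ℤ (y k) := fun k => by
    refine IsIntegral.of_pow (n := 2) two_pos ?_
    rw [hy2]
    exact (hD.smul D).add (isIntegral_algebraMap (R := ℤ))
  let σ₀ : L →ₐ[ℚ] ℂ := (Complex.ofRealAm.restrictScalars ℚ).comp L.val
  set d := Fintype.card (L →ₐ[ℚ] ℂ) with hd
  have hd1 : 1 ≤ d := Fintype.card_pos_iff.2 ⟨σ₀⟩
  obtain ⟨C, hC⟩ := fwdDiff_iter_sqrt_bound d hd1
  let z : ℕ → L := fun k => ∑ j ∈ Finset.range (d + 1), ((-1) ^ (d - j) * (d.choose j : ℤ)) • y (k + j)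
  have hzint : ∀ k, IsIntegral ℤ (z k) := fun k =>
    IsIntegral.sum _ fun j _ => (hyint _).smul _
  have hzval : ∀ k, (z k : ℝ) = D * (fwdDiff (1 : ℝ))^[d] Real.sqrt (c + k) := by
    intro k
    rw [fwdDiff_iter_eq_sum_shift, Finset.mul_sum]
    simp only [z, y, AddSubmonoidClass.coe_finsetSum]
    refine Finset.sum_congr rfl fun j _ => ?_
    simp
    ring_nf
  have hz0 : ∀ k, z k ≠ 0 := fun k h => by
    have h1 := hzval k
    rw [h] at h1
    exact mul_ne_zero (Int.cast_ne_zero.2 hD0) (hC (c + k) (by positivity)).1 h1.symm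
  let S : ℝ := ∑ σ : L →ₐ[ℚ] ℂ, ‖σ ⟨c, hcL⟩‖
  have hS : ∀ σ : L →ₐ[ℚ] ℂ, ‖σ ⟨c, hcL⟩‖ ≤ S := fun σ =>
    Finset.single_le_sum (f := fun σ : L →ₐ[ℚ] ℂ => ‖σ ⟨c, hcL⟩‖) (fun _ _ => norm_nonneg _)
      (Finset.mem_univ σ)
  have hS0 : 0 ≤ S := Finset.sum_nonneg fun _ _ => norm_nonneg _
  let B : ℝ := |(D : ℝ)| * √(S + 1 + d)
  have hybound : ∀ (σ : L →ₐ[ℚ] ℂ) (k j : ℕ), 1 ≤ k → j ≤ d →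
      ‖σ (y (k + j))‖ ≤ B * √(c + k) := by
    intro σ k j hk hj
    have hk' : (1 : ℝ) ≤ k := by exact_mod_cast hk
    have hj' : (j : ℝ) ≤ d := by exact_mod_cast hj
    rw [mul_assoc, ← Real.sqrt_mul (by positivity)]
    refine le_of_sq_le_sq ?_ (by positivity)
    rw [← norm_pow, ← map_pow, hy2, mul_pow, Real.sq_sqrt (by positivity), sq_abs]
    have h1 : σ (D • D • (⟨c, hcL⟩ : L) + ((D ^ 2 * (k + j : ℕ) : ℤ) : L))
        = (D : ℂ) ^ 2 * (σ ⟨c, hcL⟩ + ((k + j : ℕ) : ℂ)) := by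
      simp only [map_add, map_mul, map_intCast, zsmul_eq_mul]
      push_cast
      ring
    rw [h1, norm_mul, norm_pow, Complex.norm_intCast, sq_abs]
    refine mul_le_mul_of_nonneg_left ((norm_add_le _ _).trans ?_) (by positivity)
    rw [Complex.norm_natCast]
    push_cast
    nlinarith [hS σ, mul_nonneg hS0 (by linarith : (0 : ℝ) ≤ c + k - 1),
      mul_nonneg (by positivity : (0 : ℝ) ≤ d) (by linarith : (0 : ℝ) ≤ c + k - 1)]
  let E : ℝ := ∑ j ∈ Finset.range (d + 1), |((-1) ^ (d - j) * (d.choose j : ℤ) : ℤ)| * B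
  have hzbound : ∀ (σ : L →ₐ[ℚ] ℂ) (k : ℕ), 1 ≤ k → ‖σ (z k)‖ ≤ E * √(c + k) := by
    intro σ k hk
    simp only [z, E, map_sum, Finset.sum_mul]
    refine norm_sum_le_of_le _ fun j hj => ?_
    rw [map_zsmul, zsmul_eq_mul, norm_mul, Complex.norm_intCast, mul_assoc]
    push_cast
    exact mul_le_mul_of_nonneg_left
      (hybound σ k j hk (Nat.lt_succ_iff.1 (Finset.mem_range.1 hj))) (abs_nonneg _)
  have hmain : ∀ k : ℕ, 1 ≤ k → √(c + k) ≤ |(D : ℝ)| * C * E ^ (d - 1) := by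
    intro k hk
    have hk' : (1 : ℝ) ≤ k := by exact_mod_cast hk
    set s := √(c + k) with hs
    have hs1 : 1 ≤ s := Real.one_le_sqrt.2 (by linarith)
    have hs2 : s ^ 2 = c + k := Real.sq_sqrt (by positivity)
    have h1 := one_le_prod_norm_embeddings (hzint k) (hz0 k)
    rw [← Finset.mul_prod_erase _ _ (Finset.mem_univ σ₀)] at h1
    have h2 : ∏ σ ∈ Finset.univ.erase σ₀, ‖σ (z k)‖ ≤ (E * s) ^ (d - 1) := by
      refine (Finset.prod_le_prod (fun _ _ => norm_nonneg _)
        (fun σ _ => hzbound σ k hk)).trans_eq ?_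
      rw [Finset.prod_const, Finset.card_erase_of_mem (Finset.mem_univ _), Finset.card_univ]
    have h3 : ‖σ₀ (z k)‖ = |(D : ℝ)| * |(fwdDiff (1 : ℝ))^[d] Real.sqrt (c + k)| := by
      rw [← abs_mul, ← hzval]
      exact Complex.norm_real _
    have h4 := (hC (c + k) (by positivity)).2
    rw [← hs, ← hs2, ← pow_mul] at h4
    rw [h3, ← hs2] at h1
    set A := |(fwdDiff (1 : ℝ))^[d] Real.sqrt (s ^ 2)|
    have h5 : 1 ≤ |(D : ℝ)| * A * (E * s) ^ (d - 1) :=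
      h1.trans (mul_le_mul_of_nonneg_left h2 (by positivity))
    have hE : 0 ≤ E := Finset.sum_nonneg fun _ _ => by positivity
    obtain ⟨e, he⟩ : ∃ e, d = e + 1 := ⟨d - 1, by omega⟩
    -- Multiply the norm bound by `s ^ (2d) = x ^ d`: the decay at the real place turns `A s ^ (2d)`
    -- into `C s`, and the other places contribute `s ^ (d - 1)`.
    have h6 : s ^ (2 * d) ≤ |(D : ℝ)| * C * E ^ (d - 1) * s ^ d :=
      calc s ^ (2 * d) = 1 * s ^ (2 * d) := (one_mul _).symm
        _ ≤ |(D : ℝ)| * A * (E * s) ^ (d - 1) * s ^ (2 * d) := by gcongr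
        _ = |(D : ℝ)| * (E * s) ^ (d - 1) * (A * s ^ (2 * d)) := by ring
        _ ≤ |(D : ℝ)| * (E * s) ^ (d - 1) * (C * s) := by gcongr
        _ = |(D : ℝ)| * C * E ^ (d - 1) * s ^ d := by
          rw [he, Nat.add_sub_cancel]
          ring
    rw [two_mul, pow_add] at h6
    exact (le_self_pow₀ hs1 (by omega)).trans (le_of_mul_le_mul_right h6 (by positivity))
  obtain ⟨k, hk⟩ := exists_nat_gt ((|(D : ℝ)| * C * E ^ (d - 1)) ^ 2 + 1)
  have hk1 : 1 ≤ k := by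
    have : (1 : ℝ) < k := by nlinarith [sq_nonneg (|(D : ℝ)| * C * E ^ (d - 1))]
    exact_mod_cast this.le
  have h := hmain k hk1
  have h' := Real.sq_sqrt (show 0 ≤ c + k by positivity)
  nlinarith [Real.sqrt_nonneg (c + k)]

/-! ### From a finite-dimensional rational space to a number field -/

theorem isAlgebraic_of_one_div_add_natCast_mem {V : Submodule ℚ ℝ} (hV : V.FG) {c : ℝ}
    (hc : 0 < c) (h : ∀ k : ℕ, (c + k)⁻¹ ∈ V) : IsAlgebraic ℚ c := by
  have : Module.Finite ℚ V := Module.Finite.iff_fg.2 hV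
  have hdep : ¬ LinearIndependent ℚ (fun k : ℕ => (c + k)⁻¹) := by
    intro hli
    have hli' : LinearIndependent ℚ (fun k : ℕ => (⟨(c + k)⁻¹, h k⟩ : V)) :=
      LinearIndependent.of_comp V.subtype hli
    exact Infinite.not_finite (α := ℕ) hli'.finite
  rw [linearIndependent_iff'] at hdep
  push Not at hdep
  obtain ⟨s, a, hsum, i, hi, hai⟩ := hdep
  -- Clear denominators in the linear relation. At `-i` only the `i`-th summand survives, so the
  -- polynomial is nonzero.
  refine ⟨∑ j ∈ s, Polynomial.C (a j) * ∏ l ∈ s.erase j, (Polynomial.X + Polynomial.C (l : ℚ)),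
    ?_, ?_⟩
  · intro h0
    have h1 := congrArg (Polynomial.eval (-(i : ℚ))) h0
    rw [Polynomial.eval_finsetSum, Finset.sum_eq_single_of_mem i hi] at h1
    · simp only [Polynomial.eval_mul, Polynomial.eval_C, Polynomial.eval_prod, Polynomial.eval_add,
        Polynomial.eval_X, Polynomial.eval_zero, mul_eq_zero, hai, false_or,
        Finset.prod_eq_zero_iff] at h1
      obtain ⟨l, hl, hl0⟩ := h1
      refine Finset.ne_of_mem_erase hl ?_
      have : (l : ℚ) = i := by linarith
      exact_mod_cast this
    · intro j _ hj
      rw [Polynomial.eval_mul, Polynomial.eval_prod,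
        Finset.prod_eq_zero (Finset.mem_erase.2 ⟨hj.symm, hi⟩) (by simp), mul_zero]
  · have h1 : ∀ j ∈ s, (a j : ℝ) * ∏ l ∈ s.erase j, (c + (l : ℝ))
        = (a j • (c + j)⁻¹) * ∏ l ∈ s, (c + (l : ℝ)) := by
      intro j hj
      rw [← Finset.mul_prod_erase s _ hj, Rat.smul_def]
      have : c + (j : ℝ) ≠ 0 := by positivity
      field_simp
    have h2 : ∑ j ∈ s, (a j : ℝ) * ∏ l ∈ s.erase j, (c + (l : ℝ)) = 0 := by
      rw [Finset.sum_congr rfl h1, ← Finset.sum_mul, hsum, zero_mul]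
    simpa [map_sum, map_prod] using h2

theorem not_fg_of_sqrt_add_natCast_mem {V : Submodule ℚ ℝ} {c : ℝ} (hc : 0 < c)
    (h : ∀ k : ℕ, √(c + k) ∈ V) (h' : ∀ k : ℕ, (√(c + k))⁻¹ ∈ V) : ¬ V.FG := by
  intro hV
  have hca : IsAlgebraic ℚ c := by
    refine isAlgebraic_of_one_div_add_natCast_mem (hV.mul hV) hc fun k => ?_
    have := Submodule.mul_mem_mul (h' k) (h' k)
    rwa [← mul_inv, Real.mul_self_sqrt (by positivity)] at this
  have : Module.Finite ℚ V := Module.Finite.iff_fg.2 hV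
  have hspan : (Submodule.span ℚ (Set.range fun k : ℕ => √(c + k))).FG :=
    hV.of_le (Submodule.span_le.2 (by rintro _ ⟨k, rfl⟩; exact h k))
  obtain ⟨T, hT, hTspan⟩ := (Submodule.fg_span_iff_fg_span_finset_subset _).1 hspan
  have : FiniteDimensional ℚ (IntermediateField.adjoin ℚ (T : Set ℝ)) := by
    refine IntermediateField.finiteDimensional_adjoin fun x hx => ?_
    obtain ⟨k, rfl⟩ := hT hx
    refine IsIntegral.of_pow (n := 2) two_pos ?_
    simp only
    rw [Real.sq_sqrt (by positivity)]
    simpa using hca.isIntegral.add (isIntegral_algebraMap (R := ℚ) (A := ℝ) (x := (k : ℚ)))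
  obtain ⟨k, hk⟩ := IntermediateField.exists_sqrt_add_natCast_notMem
    (IntermediateField.adjoin ℚ (T : Set ℝ)) hc
  refine hk ?_
  have h1 : √(c + k) ∈ Submodule.span ℚ (T : Set ℝ) :=
    hTspan ▸ Submodule.subset_span ⟨k, rfl⟩
  exact (Submodule.span_le (p := (IntermediateField.adjoin ℚ (T : Set ℝ)).toSubalgebra.toSubmodule)).2
    (IntermediateField.subset_adjoin ℚ _) h1

/-! ### Square roots of a coset in `SL(2, ℝ)` -/

/-- A matrix in `SL(2, ℝ)` of trace larger than `-2` has an explicit square root. -/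
theorem exists_sq_eq_of_trace (Y : SLR 2) (hY : -2 < (Y : Matrix (Fin 2) (Fin 2) ℝ).trace) :
    ∃ X : SLR 2, X ^ 2 = Y ∧
      (X : Matrix (Fin 2) (Fin 2) ℝ).trace = √((Y : Matrix (Fin 2) (Fin 2) ℝ).trace + 2) ∧
      X 1 0 = Y 1 0 / √((Y : Matrix (Fin 2) (Fin 2) ℝ).trace + 2) := by
  set t := (Y : Matrix (Fin 2) (Fin 2) ℝ).trace with ht
  rw [Matrix.trace_fin_two] at ht
  have hdet := Y.det_coe
  rw [Matrix.det_fin_two] at hdet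
  set s := √(t + 2) with hs
  have hs0 : 0 < s := Real.sqrt_pos.2 (by linarith)
  have hs2 : s ^ 2 = t + 2 := Real.sq_sqrt (by linarith)
  -- By Cayley–Hamilton, `(Y + 1)² = (t + 2) Y`.
  refine ⟨⟨s⁻¹ • ((Y : Matrix (Fin 2) (Fin 2) ℝ) + 1), ?_⟩, ?_, ?_, ?_⟩
  · rw [Matrix.det_fin_two]
    simp
    field_simp
    linear_combination hdet - ht - hs2
  · apply Subtype.ext
    change (s⁻¹ • ((Y : Matrix (Fin 2) (Fin 2) ℝ) + 1)) ^ 2 = Y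
    rw [pow_two]
    ext i j
    fin_cases i <;> fin_cases j <;>
      simp [Matrix.mul_apply, Fin.sum_univ_two] <;> field_simp
    · linear_combination (-1 : ℝ) * hdet - Y 0 0 * (hs2 + ht)
    · linear_combination (-Y 0 1) * (hs2 + ht)
    · linear_combination (-Y 1 0) * (hs2 + ht)
    · linear_combination (-1 : ℝ) * hdet - Y 1 1 * (hs2 + ht)
  · rw [Matrix.trace_fin_two]
    simp
    field_simp
    linear_combination - ht - hs2
  · simp
    field_simp

theorem mem_SLZ_of_eq_map {n : ℕ} {X : SLR n} {A : Matrix (Fin n) (Fin n) ℤ} (hA : A.det = 1)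
    (h : (X : Matrix (Fin n) (Fin n) ℝ) = A.map (Int.castRingHom ℝ)) : X ∈ SLZ n :=
  ⟨⟨A, hA⟩, Subtype.ext h.symm⟩

/-- The upper unitriangular matrix with entry `k`. -/
def unitriangular (k : ℤ) : SLR 2 := ⟨!![1, (k : ℝ); 0, 1], by simp⟩

theorem unitriangular_mem (k : ℤ) : unitriangular k ∈ SLZ 2 :=
  mem_SLZ_of_eq_map (A := !![1, k; 0, 1]) (by simp) (by
    ext i j
    fin_cases i <;> fin_cases j <;> simp [unitriangular])

theorem mul_apply_two (A B : SLR 2) (i j : Fin 2) :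
    (A * B) i j = A i 0 * B 0 j + A i 1 * B 1 j := by
  rw [Matrix.SpecialLinearGroup.coe_mul, Matrix.mul_apply, Fin.sum_univ_two]

theorem exists_coset_entry_ne_zero (g : SLR 2) : ∃ h ∈ coset g, h 1 0 ≠ 0 := by
  by_cases h0 : g 1 0 = 0
  · let v : SLR 2 := ⟨!![1, 0; 1, 1], by simp⟩
    refine ⟨g * v, ⟨v, mem_SLZ_of_eq_map (A := !![1, 0; 1, 1]) (by simp) ?_, rfl⟩, ?_⟩
    · ext i j
      fin_cases i <;> fin_cases j <;> simp [v]
    · have hdet := g.det_coe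
      rw [Matrix.det_fin_two] at hdet
      intro h1
      rw [mul_apply_two] at h1
      simp [h0, v] at h1
      simp [h0, h1] at hdet
  · exact ⟨g, ⟨1, one_mem _, (mul_one g).symm⟩, h0⟩

theorem exists_entry_sqrt_coset_notMem (g : SLR 2) {V : Submodule ℚ ℝ} (hV : V.FG) :
    ∃ X : SLR 2, X ^ 2 ∈ coset g ∧ 2 < (X : Matrix (Fin 2) (Fin 2) ℝ).trace ∧
      ∃ i j, X i j ∉ V := by
  by_contra! H
  obtain ⟨h, ⟨γ, hγ, rfl⟩, hp⟩ := exists_coset_entry_ne_zero g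
  obtain ⟨h, hh⟩ : ∃ h, h = g * γ := ⟨_, rfl⟩
  rw [← hh] at hp
  set a := h 0 0 + h 1 1 with ha
  set q := |h 1 0| with hq
  have hq0 : 0 < q := abs_pos.2 hp
  have key : ∀ k : ℕ, 2 < a + k * q → √(a + k * q + 2) ∈ V ∧ q / √(a + k * q + 2) ∈ V := by
    intro k hk
    -- The sign of the lower-left entry makes the trace grow by `+q` with each `k`.
    obtain ⟨ε, hε⟩ : ∃ ε : ℤ, q = ε * h 1 0 := by
      rcases abs_choice (h 1 0) with h1 | h1
      · exact ⟨1, by rw [hq, h1]; simp⟩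
      · exact ⟨-1, by rw [hq, h1]; simp⟩
    let u := unitriangular (ε * k)
    have htr : ((h * u : SLR 2) : Matrix (Fin 2) (Fin 2) ℝ).trace = a + k * q := by
      rw [Matrix.trace_fin_two, hε, ha, mul_apply_two, mul_apply_two]
      simp [u, unitriangular]
      ring
    have h10 : (h * u : SLR 2) 1 0 = h 1 0 := by
      rw [mul_apply_two]
      simp [u, unitriangular]
    obtain ⟨X, hX, hXtr, hX10⟩ := exists_sq_eq_of_trace (h * u) (by rw [htr]; linarith)
    rw [htr] at hXtr hX10
    rw [h10] at hX10
    have hXV := H X ⟨γ * u, mul_mem hγ (unitriangular_mem _), by rw [hX, hh, mul_assoc]⟩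
      (by rw [hXtr]; exact Real.lt_sqrt_of_sq_lt (by linarith))
    constructor
    · rw [← hXtr, Matrix.trace_fin_two]
      exact add_mem (hXV 0 0) (hXV 1 1)
    · have h1 := V.smul_mem (ε : ℚ) (hXV 1 0)
      rw [hX10, Rat.smul_def, ← mul_div_assoc, Rat.cast_intCast, ← hε] at h1
      exact h1
  obtain ⟨K, hK⟩ := exists_nat_gt ((2 - a) / q)
  rw [div_lt_iff₀ hq0] at hK
  -- The shift `K` brings every trace `a + (K + k) q` above 2, as `key` requires, and makes `c`
  -- positive.
  set c := (a + 2) / q + K with hc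
  have hc0 : 0 < c := by
    have h1 : c = (a + 2 + K * q) / q := by rw [hc]; field_simp
    rw [h1]
    exact div_pos (by linarith) hq0
  have hck : ∀ k : ℕ, a + ((K + k : ℕ) : ℝ) * q + 2 = q * (c + k) := by
    intro k
    rw [hc]
    push_cast
    field_simp
    ring
  have hkey : ∀ k : ℕ, √q * √(c + k) ∈ V ∧ q / (√q * √(c + k)) ∈ V := by
    intro k
    have h1 : (0 : ℝ) ≤ k * q := by positivity
    have := key (K + k) (by push_cast; linarith)
    rwa [hck, Real.sqrt_mul hq0.le] at this
  have hsq : √q ≠ 0 := (Real.sqrt_pos.2 hq0).ne'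
  refine not_fg_of_sqrt_add_natCast_mem (V := V.map (LinearMap.mulLeft ℚ (√q)⁻¹)) hc0
    (fun k => ?_) (fun k => ?_) (hV.map _)
  · refine ⟨_, (hkey k).1, ?_⟩
    rw [LinearMap.mulLeft_apply, inv_mul_cancel_left₀ hsq]
  · refine ⟨_, (hkey k).2, ?_⟩
    have h1 : √(c + k) ≠ 0 := (Real.sqrt_pos.2 (by positivity)).ne'
    rw [LinearMap.mulLeft_apply]
    nth_rewrite 2 [← Real.mul_self_sqrt hq0.le]
    field_simp

/-- A maximal rationally independent set of entries is infinite, since otherwise its span would be a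
finitely generated `V` containing every entry; it is independent over `ℤ` too. -/
theorem aleph0_le_rank_entryModule {n : ℕ} {A : Set (SLR n)}
    (hA : ∀ V : Submodule ℚ ℝ, V.FG → ∃ X ∈ A, ∃ i j, X i j ∉ V) :
    Cardinal.aleph0 ≤ Module.rank ℤ (entryModule A) := by
  obtain ⟨b, hb, hspan, hli⟩ := exists_linearIndependent ℚ
    {r : ℝ | ∃ X ∈ A, ∃ i j : Fin n, r = (X : Matrix (Fin n) (Fin n) ℝ) i j}
  have hinf : Infinite b := by
    refine Set.infinite_coe_iff.2 fun hfin => ?_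
    obtain ⟨X, hX, i, j, hij⟩ := hA _ (Submodule.fg_span hfin)
    exact hij (hspan ▸ Submodule.subset_span ⟨X, hX, i, j, rfl⟩)
  have hliZ : LinearIndependent ℤ ((↑) : b → ℝ) := (LinearIndependent.iff_fractionRing ℤ ℚ).2 hli
  have hli' : LinearIndependent ℤ
      (fun x : b => (⟨x, Submodule.subset_span (hb x.2)⟩ : entryModule A)) :=
    LinearIndependent.of_comp (entryModule A).subtype hliZ
  exact (Cardinal.aleph0_le_mk b).trans hli'.cardinal_le_rank

/-! ### Block embeddings of `SL(m)` in `SL(n)` -/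

section BlockEmbedding

variable {R S : Type*} [CommRing R] [CommRing S] {m n : ℕ}

/-- The matrix with block `x` in the rows and columns `f`, and zeros elsewhere. -/
def corner (f : Fin m ↪ Fin n) : Matrix (Fin m) (Fin m) R →ₗ[R] Matrix (Fin n) (Fin n) R where
  toFun x := (1 : Matrix (Fin n) (Fin n) R).submatrix id f * x * (1 : Matrix _ _ R).submatrix f id
  map_add' x y := by rw [Matrix.mul_add, Matrix.add_mul]
  map_smul' a x := by simp

theorem corner_apply (f : Fin m ↪ Fin n) (x : Matrix (Fin m) (Fin m) R) :
    corner f x = (1 : Matrix (Fin n) (Fin n) R).submatrix id f * x *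
      (1 : Matrix (Fin n) (Fin n) R).submatrix f id := rfl

theorem submatrix_one_mul_submatrix_one (f : Fin m ↪ Fin n) :
    (1 : Matrix (Fin n) (Fin n) R).submatrix f id * (1 : Matrix (Fin n) (Fin n) R).submatrix id f
      = 1 := by
  rw [← Matrix.submatrix_mul _ _ f id f Function.bijective_id, one_mul,
    Matrix.submatrix_one f f.injective]

theorem corner_mul (f : Fin m ↪ Fin n) (x y : Matrix (Fin m) (Fin m) R) :
    corner f (x * y) = corner f x * corner f y := by
  have h : (1 : Matrix (Fin n) (Fin n) R).submatrix f id *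
      ((1 : Matrix (Fin n) (Fin n) R).submatrix id f *
        (y * (1 : Matrix (Fin n) (Fin n) R).submatrix f id)) =
      y * (1 : Matrix (Fin n) (Fin n) R).submatrix f id := by
    rw [← Matrix.mul_assoc, submatrix_one_mul_submatrix_one, Matrix.one_mul]
  simp only [corner_apply, Matrix.mul_assoc, h]

theorem trace_corner (f : Fin m ↪ Fin n) (x : Matrix (Fin m) (Fin m) R) :
    (corner f x).trace = x.trace := by
  rw [corner_apply, Matrix.trace_mul_comm, ← Matrix.mul_assoc, submatrix_one_mul_submatrix_one,
    Matrix.one_mul]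

theorem det_one_add_corner (f : Fin m ↪ Fin n) (x : Matrix (Fin m) (Fin m) R) :
    (1 + corner f x).det = (1 + x).det := by
  rw [corner_apply, Matrix.det_one_add_mul_comm, ← Matrix.mul_assoc,
    submatrix_one_mul_submatrix_one, Matrix.one_mul]

theorem corner_apply_apply (f : Fin m ↪ Fin n) (x : Matrix (Fin m) (Fin m) R) (i j : Fin m) :
    corner f x (f i) (f j) = x i j := by
  simp [corner_apply, Matrix.mul_apply, Matrix.one_apply]

theorem corner_map (f : Fin m ↪ Fin n) (φ : R →+* S) (x : Matrix (Fin m) (Fin m) R) :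
    (corner f x).map φ = corner f (x.map φ) := by
  simp only [corner_apply, Matrix.map_mul, ← Matrix.submatrix_map]
  rw [Matrix.map_one _ φ.map_zero φ.map_one]

/-- The embedding of `SL(m)` in `SL(n)` as the block with rows and columns `f`. -/
def blockEmbedding (f : Fin m ↪ Fin n) :
    Matrix.SpecialLinearGroup (Fin m) R →* Matrix.SpecialLinearGroup (Fin n) R where
  toFun X := ⟨1 + corner f (X - 1 : Matrix (Fin m) (Fin m) R), by
    rw [det_one_add_corner, add_sub_cancel, X.det_coe]⟩
  map_one' := Subtype.ext (by simp)
  map_mul' X Y := Subtype.ext (by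
    change 1 + corner f (X * Y - 1 : Matrix (Fin m) (Fin m) R) =
      (1 + corner f (X - 1 : Matrix (Fin m) (Fin m) R)) *
        (1 + corner f (Y - 1 : Matrix (Fin m) (Fin m) R))
    have h : (X * Y - 1 : Matrix (Fin m) (Fin m) R) = (X - 1) + (Y - 1) + (X - 1) * (Y - 1) := by
      noncomm_ring
    simp only [h, map_add, corner_mul]
    noncomm_ring)

theorem blockEmbedding_apply_apply (f : Fin m ↪ Fin n) (X : Matrix.SpecialLinearGroup (Fin m) R)
    (i j : Fin m) : blockEmbedding f X (f i) (f j) = X i j := by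
  change (1 + corner f (X - 1 : Matrix (Fin m) (Fin m) R)) (f i) (f j) = _
  rw [Matrix.add_apply, corner_apply_apply]
  simp [Matrix.one_apply]

theorem blockEmbedding_refl (X : Matrix.SpecialLinearGroup (Fin m) R) :
    blockEmbedding (Function.Embedding.refl _) X = X := by
  ext i j
  exact blockEmbedding_apply_apply (Function.Embedding.refl _) X i j

theorem map_blockEmbedding (f : Fin m ↪ Fin n) (φ : R →+* S)
    (X : Matrix.SpecialLinearGroup (Fin m) R) :
    Matrix.SpecialLinearGroup.map φ (blockEmbedding f X) =
      blockEmbedding f (Matrix.SpecialLinearGroup.map φ X) := by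
  apply Subtype.ext
  change φ.mapMatrix (1 + corner f (X - 1 : Matrix (Fin m) (Fin m) R)) =
    1 + corner f (φ.mapMatrix (X : Matrix (Fin m) (Fin m) R) - 1)
  rw [map_add, map_one]
  congr 1
  refine (corner_map f φ _).trans (congrArg _ ?_)
  exact (map_sub φ.mapMatrix _ _).trans (by rw [map_one])

end BlockEmbedding

theorem blockEmbedding_mem_SLZ {m n : ℕ} (f : Fin m ↪ Fin n) {γ : SLR m} (hγ : γ ∈ SLZ m) :
    blockEmbedding f γ ∈ SLZ n := by
  obtain ⟨γ, rfl⟩ := hγ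
  exact ⟨_, map_blockEmbedding f _ γ⟩

/-! ### Hyperbolic matrices as exponentials -/

theorem exp_smul_of_mul_self {𝔸 : Type*} [NormedRing 𝔸] [NormedAlgebra ℝ 𝔸] [CompleteSpace 𝔸]
    {e : 𝔸} (he : e * e = e) (s : ℝ) :
    NormedSpace.exp (s • e) = 1 + (Real.exp s - 1) • e := by
  have h1 : HasSum (fun k : ℕ => ((k.factorial : ℝ)⁻¹ * s ^ k) • e) (Real.exp s • e) := by
    rw [Real.exp_eq_exp_ℝ]
    exact (NormedSpace.exp_series_hasSum_exp' (𝕂 := ℝ) s).smul_const e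
  have h2 := h1.add (hasSum_ite_eq (0 : ℕ) (1 - e))
  have h3 := NormedSpace.exp_series_hasSum_exp' (𝕂 := ℝ) (s • e)
  rw [h3.unique (h2.congr_fun ?_)]
  · rw [sub_smul, one_smul]
    abel
  · intro k
    rcases k with _ | k
    · simp
    · simp [smul_pow, (show IsIdempotentElem e from he).pow_succ_eq, smul_smul]

open scoped Matrix.Norms.Operator in
theorem Matrix.exp_smul_of_mul_self {n : ℕ} {e : Matrix (Fin n) (Fin n) ℝ} (he : e * e = e)
    (s : ℝ) : NormedSpace.exp (s • e) = 1 + (Real.exp s - 1) • e :=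
  MidpointBlocking.exp_smul_of_mul_self he s

/-- Trace above 2 gives distinct positive eigenvalues `l` and `l⁻¹`, so `X = l e + l⁻¹ (1 - e)` with
`e` the spectral projection. The logarithm is `log l` times `e - (1 - e)`, placed in the block. -/
theorem exists_slExp_eq_blockEmbedding {n : ℕ} (f : Fin 2 ↪ Fin n) (X : SLR 2)
    (hX : 2 < (X : Matrix (Fin 2) (Fin 2) ℝ).trace) :
    ∃ x, slExp x = blockEmbedding f X := by
  set τ := (X : Matrix (Fin 2) (Fin 2) ℝ).trace with hτ
  obtain ⟨l, hl1, hl⟩ : ∃ l : ℝ, 1 < l ∧ l + l⁻¹ = τ := by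
    have h1 : √(τ ^ 2 - 4) ^ 2 = τ ^ 2 - 4 := Real.sq_sqrt (by nlinarith)
    have h2 := Real.sqrt_nonneg (τ ^ 2 - 4)
    refine ⟨(τ + √(τ ^ 2 - 4)) / 2, by linarith, ?_⟩
    have h3 : τ + √(τ ^ 2 - 4) ≠ 0 := by linarith
    field_simp
    linear_combination h1
  set μ := l⁻¹ with hμ
  have hl0 : 0 < l := by linarith
  have hlμ : l * μ = 1 := mul_inv_cancel₀ hl0.ne'
  have hne : l - μ ≠ 0 := by
    have : μ < 1 := inv_lt_one_of_one_lt₀ hl1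
    linarith
  have hCH : (X * X : Matrix (Fin 2) (Fin 2) ℝ) = τ • (X : Matrix (Fin 2) (Fin 2) ℝ) - 1 := by
    have hdet := X.det_coe
    rw [Matrix.det_fin_two] at hdet
    rw [Matrix.trace_fin_two] at hτ
    ext i j
    fin_cases i <;> fin_cases j <;> simp [Matrix.mul_apply, Fin.sum_univ_two, hτ] <;>
      linarith
  set e : Matrix (Fin 2) (Fin 2) ℝ := (l - μ)⁻¹ • ((X : Matrix (Fin 2) (Fin 2) ℝ) - μ • 1) with he
  have hee : e * e = e := by
    have h1 : ((X : Matrix (Fin 2) (Fin 2) ℝ) - μ • 1) * ((X : Matrix (Fin 2) (Fin 2) ℝ) - μ • 1)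
        = (l - μ) • ((X : Matrix (Fin 2) (Fin 2) ℝ) - μ • 1) := by
      rw [sub_mul, mul_sub, mul_sub, hCH, ← hl]
      simp only [smul_mul_assoc, mul_smul_comm, one_mul, mul_one, smul_sub, smul_smul, sub_mul,
        hlμ]
      module
    rw [he, smul_mul_assoc, mul_smul_comm, h1, inv_smul_smul₀ hne]
  have hee' : (1 - e) * (1 - e) = 1 - e := (show IsIdempotentElem e from hee).one_sub
  have hmul : e * (1 - e) = 0 := by rw [mul_sub, hee, mul_one, sub_self]
  have hmul' : (1 - e) * e = 0 := by rw [sub_mul, hee, one_mul, sub_self]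
  have htr : e.trace = 1 := by
    rw [he, Matrix.trace_smul, Matrix.trace_sub, Matrix.trace_smul, ← hτ, ← hl]
    simp
    field_simp
    ring
  set s := Real.log l
  have hs : Real.exp s = l := Real.exp_log hl0
  have hs' : Real.exp (-s) = μ := by rw [Real.exp_neg, hs]
  let x : Matrix (Fin n) (Fin n) ℝ := s • corner f e + (-s) • corner f (1 - e)
  have hx : x.trace = 0 := by
    simp [x, trace_corner, htr, Matrix.trace_sub]
    ring
  refine ⟨⟨x, LinearMap.mem_ker.2 hx⟩, Subtype.ext ?_⟩
  change NormedSpace.exp x = 1 + corner f (X - 1 : Matrix (Fin 2) (Fin 2) ℝ)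
  have hcomm : Commute (s • corner f e) ((-s) • corner f (1 - e)) := by
    refine (Commute.smul_left ?_ _).smul_right _
    rw [Commute, SemiconjBy, ← corner_mul, ← corner_mul, hmul, hmul']
  rw [Matrix.exp_add_of_commute _ _ hcomm,
    Matrix.exp_smul_of_mul_self (by rw [← corner_mul, hee]),
    Matrix.exp_smul_of_mul_self (by rw [← corner_mul, hee']), hs, hs', add_mul, one_mul, mul_add,
    mul_one, smul_mul_smul_comm, ← corner_mul, hmul, map_zero, smul_zero, add_zero, add_assoc,
    ← map_smul, ← map_smul, ← map_add]
  congr 2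
  have h1 : (X : Matrix (Fin 2) (Fin 2) ℝ) = (l - μ) • e + μ • 1 := by
    rw [he, smul_inv_smul₀ hne, sub_add_cancel]
  rw [h1]
  module

theorem slExp_zero {n : ℕ} : slExp (0 : LieAlgebra.SpecialLinear.sl (Fin n) ℝ) = 1 :=
  Subtype.ext NormedSpace.exp_zero

theorem slExp_two_smul {n : ℕ} (x : LieAlgebra.SpecialLinear.sl (Fin n) ℝ) :
    slExp ((2 : ℝ) • x) = slExp x ^ 2 := by
  apply Subtype.ext
  change NormedSpace.exp ((2 : ℝ) • (x : Matrix (Fin n) (Fin n) ℝ)) =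
    NormedSpace.exp (x : Matrix (Fin n) (Fin n) ℝ) ^ 2
  rw [← Matrix.exp_nsmul, ofNat_smul_eq_nsmul]

theorem exists_slExp_conj {n : ℕ} (a : SLR n) (x : LieAlgebra.SpecialLinear.sl (Fin n) ℝ) :
    ∃ y, ∀ t : ℝ, slExp (t • y) = a * slExp (t • x) * a⁻¹ := by
  let A : Matrix (Fin n) (Fin n) ℝ := a
  have hA : IsUnit A := (Matrix.isUnit_iff_isUnit_det _).2 (by rw [a.det_coe]; exact isUnit_one)
  have hinv : ((a⁻¹ : SLR n) : Matrix (Fin n) (Fin n) ℝ) = A⁻¹ := by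
    refine (Matrix.inv_eq_left_inv ?_).symm
    rw [← Matrix.SpecialLinearGroup.coe_mul, inv_mul_cancel, Matrix.SpecialLinearGroup.coe_one]
  have htr : (A * x * A⁻¹).trace = 0 := by
    rw [Matrix.trace_mul_comm, ← Matrix.mul_assoc,
      Matrix.nonsing_inv_mul _ ((Matrix.isUnit_iff_isUnit_det _).1 hA), Matrix.one_mul]
    exact LinearMap.mem_ker.1 x.2
  refine ⟨⟨A * x * A⁻¹, LinearMap.mem_ker.2 htr⟩, fun t => Subtype.ext ?_⟩
  rw [Matrix.SpecialLinearGroup.coe_mul, Matrix.SpecialLinearGroup.coe_mul, hinv]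
  change NormedSpace.exp (t • (A * x * A⁻¹)) =
    A * NormedSpace.exp (t • (x : Matrix (Fin n) (Fin n) ℝ)) * A⁻¹
  rw [← Matrix.exp_conj _ _ hA, mul_smul_comm, smul_mul_assoc]

/-! ### Midpoints of connecting curves -/

/-- Translation by `a` carries connecting curves to connecting curves, conjugating the generator;
this lets the first point be the identity coset. -/
theorem MidpointBlockable.of_smul {n : ℕ} (a : SLR n) {m₁ m₂ : M n}
    (h : MidpointBlockable (a • m₁) (a • m₂)) : MidpointBlockable m₁ m₂ := by
  refine Set.Finite.subset (h.preimage (f := fun p => a • p) (MulAction.injective a).injOn) ?_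
  rintro _ ⟨c, ⟨⟨x, m, hc⟩, h0, h1⟩, rfl⟩
  obtain ⟨y, hy⟩ := exists_slExp_conj a x
  refine ⟨fun t => a • c t, ⟨⟨y, a • m, fun t => ?_⟩, congrArg (a • ·) h0, congrArg (a • ·) h1⟩,
    rfl⟩
  change a • c t = _
  rw [hc, hy, smul_smul, smul_smul, inv_mul_cancel_right]

theorem not_midpointBlockable_blockEmbedding {n : ℕ} (f : Fin 2 ↪ Fin n) (g : SLR 2) :
    ¬ MidpointBlockable (QuotientGroup.mk 1 : M n) (QuotientGroup.mk (blockEmbedding f g)) := by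
  intro hfin
  -- The entries of one chosen representative per midpoint. Any other representative differs by an
  -- integer matrix on the right, so its entries lie in the span of `T`.
  let T : Set ℝ := ⋃ p ∈ {p : M n | ∃ c ∈ connectingCurves (QuotientGroup.mk 1 : M n)
    (QuotientGroup.mk (blockEmbedding f g)), p = c half},
      Set.range fun ij : Fin n × Fin n => (Quotient.out p : SLR n) ij.1 ij.2
  have hT : T.Finite := hfin.biUnion fun _ _ => Set.finite_range _
  obtain ⟨X, ⟨γ, hγ, hX⟩, htr, i, j, hij⟩ :=
    exists_entry_sqrt_coset_notMem g (Submodule.fg_span (R := ℚ) hT)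
  refine hij ?_
  obtain ⟨x, hx⟩ := exists_slExp_eq_blockEmbedding f X htr
  -- The generator is doubled so that the curve reaches `X` at time `1/2` and `X²` at time 1.
  let c : unitInterval → M n := fun t => slExp ((t : ℝ) • (2 : ℝ) • x) • QuotientGroup.mk 1
  have hhalf : c half = QuotientGroup.mk (blockEmbedding f X) := by
    have h1 : ((half : unitInterval) : ℝ) • (2 : ℝ) • x = x := by
      rw [smul_smul]
      norm_num [half]
    simp only [c, h1, hx]
    exact congrArg _ (mul_one _)
  have hc : c ∈ connectingCurves (QuotientGroup.mk 1 : M n)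
      (QuotientGroup.mk (blockEmbedding f g)) := by
    refine ⟨⟨(2 : ℝ) • x, QuotientGroup.mk 1, fun _ => rfl⟩, ?_, ?_⟩
    · simp only [c, Set.Icc.coe_zero, zero_smul, slExp_zero, one_smul]
    · simp only [c, Set.Icc.coe_one, one_smul, slExp_two_smul, hx, ← map_pow, hX, map_mul]
      refine QuotientGroup.eq.2 ?_
      change (blockEmbedding f g * blockEmbedding f γ * 1)⁻¹ * blockEmbedding f g ∈ SLZ n
      rw [mul_one, mul_inv_rev, inv_mul_cancel_right]
      exact inv_mem (blockEmbedding_mem_SLZ f hγ)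
  obtain ⟨δ, hδ⟩ := QuotientGroup.mk_out_eq_mul (SLZ n) (blockEmbedding f X)
  obtain ⟨ε, hε⟩ := inv_mem δ.2
  have hX' : blockEmbedding f X = Quotient.out (c half) *
      Matrix.SpecialLinearGroup.map (Int.castRingHom ℝ) ε := by
    rw [hhalf]
    erw [hδ, hε]
    rw [mul_inv_cancel_right]
  rw [← blockEmbedding_apply_apply f X i j, hX', Matrix.SpecialLinearGroup.coe_mul,
    Matrix.mul_apply]
  refine sum_mem fun k _ => ?_
  have hk : (Quotient.out (c half) : SLR n) (f i) k ∈ T :=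
    Set.mem_biUnion (show c half ∈ _ from ⟨c, hc, rfl⟩) ⟨(f i, k), rfl⟩
  have h1 := Submodule.smul_mem _ ((ε k (f j) : ℤ) : ℚ) (Submodule.subset_span (R := ℚ) hk)
  rw [Rat.smul_def, mul_comm] at h1
  simpa using h1

/-- The matrix `diag(2, 1/2)`. -/
noncomputable def diagTwo : SLR 2 := ⟨!![2, 0; 0, 1 / 2], by simp [Matrix.det_fin_two]⟩

theorem mk_one_ne_mk_blockEmbedding_diagTwo {n : ℕ} (f : Fin 2 ↪ Fin n) :
    (QuotientGroup.mk 1 : M n) ≠ QuotientGroup.mk (blockEmbedding f diagTwo) := by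
  intro h
  obtain ⟨γ, hγ⟩ := QuotientGroup.eq.1 h
  rw [inv_one, one_mul] at hγ
  have h1 := blockEmbedding_apply_apply f diagTwo 1 1
  rw [← hγ] at h1
  have h2 : ((2 * γ (f 1) (f 1) : ℤ) : ℝ) = (1 : ℤ) := by
    have : ((γ (f 1) (f 1) : ℤ) : ℝ) = 1 / 2 := by simpa [diagTwo] using h1
    push_cast
    linarith
  have h3 := Int.cast_injective h2
  omega

end MidpointBlocking

open MidpointBlocking in
theorem mainTheorem10 :
    (∀ n : ℕ, 2 ≤ n →
      (∃ m₁ m₂ : MidpointBlocking.M n, m₁ ≠ m₂ ∧ ¬ MidpointBlocking.MidpointBlockable m₁ m₂) ∧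
      (∀ m : MidpointBlocking.M n, ¬ MidpointBlocking.MidpointBlockable m m)) ∧
    (∀ m₁ m₂ : MidpointBlocking.M 2, ¬ MidpointBlocking.MidpointBlockable m₁ m₂) ∧
    (∀ g : MidpointBlocking.SLR 2,
      Cardinal.aleph0 ≤ Module.rank ℤ
        (MidpointBlocking.entryModule (MidpointBlocking.Sqrt (MidpointBlocking.coset g)))) := by
  refine ⟨fun n hn => ⟨?_, fun m hm => ?_⟩, fun m₁ m₂ hm => ?_, fun g => ?_⟩
  · exact ⟨_, _, mk_one_ne_mk_blockEmbedding_diagTwo (Fin.castLEEmb hn),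
      not_midpointBlockable_blockEmbedding _ _⟩
  · obtain ⟨a, rfl⟩ := QuotientGroup.mk_surjective m
    refine not_midpointBlockable_blockEmbedding (Fin.castLEEmb hn) 1
      (MidpointBlockable.of_smul a ?_)
    rw [map_one]
    simpa using hm
  · obtain ⟨a, rfl⟩ := QuotientGroup.mk_surjective m₁
    obtain ⟨b, rfl⟩ := QuotientGroup.mk_surjective m₂
    refine not_midpointBlockable_blockEmbedding (Function.Embedding.refl _) (a⁻¹ * b)
      (MidpointBlockable.of_smul a ?_)
    rw [blockEmbedding_refl]
    simpa using hm
  · refine aleph0_le_rank_entryModule fun V hV => ?_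
    obtain ⟨X, hX, -, h⟩ := exists_entry_sqrt_coset_notMem g hV
    exact ⟨X, hX, h⟩
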